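/- For real numbers $a,b>0$ with $a\neq b$ and an exponent $r\in[-\infty,+\infty]$, let $L_r(a,b)$ denote Stolarsky's generalized logarithmic mean, $$L_r(a,b)=\left(\frac{b^r-a^r}{r(b-a)}\right)^{\frac1{r-1}}\qquad (r\in\mathbb R\setminus\{0,1\}),$$ where the remaining values are defined as the corresponding limits in $r$, that is, $$L_0(a,b)=\frac{b-a}{\ln b-\ln a},\qquad L_1(a,b)=\frac1e\left(\frac{b^b}{a^a}\right)^{\frac1{b-a}},\qquad L_{+\infty}(a,b)=\max(a,b),\qquad L_{-\infty}(a,b)=\min(a,b).$$ **Theorem.** For every $r\in(0,+\infty]$ and all real numbers $b>a>0$, $$L_r(a,b)+L_{-r}(a,b)>2L_0(a,b).$$ -/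

import Mathlib

/-- The generalized logarithmic mean of `a, b > 0` at a finite exponent `r`: the exceptional values
`r = 0`, `r = 1` and `a = b`, where the general formula is undefined, are filled in by the
corresponding limits. -/
noncomputable def genLogMeanReal (r a b : ℝ) : ℝ :=
  if a = b then a
  else if r = 0 then (b - a) / (Real.log b - Real.log a)
  else if r = 1 then 1 / Real.exp 1 * (b ^ b / a ^ a) ^ (1 / (b - a))
  else ((b ^ r - a ^ r) / (r * (b - a))) ^ (1 / (r - 1))

/-- The generalized logarithmic mean `L_r(a, b)` for an exponent `r ∈ [-∞, +∞]`, with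
`L_{+∞} = max` and `L_{-∞} = min`. -/
noncomputable def genLogMean (r : EReal) (a b : ℝ) : ℝ :=
  if r = ⊤ then max a b
  else if r = ⊥ then min a b
  else genLogMeanReal r.toReal a b

open Real Set Filter Topology

/-! Put a = e^(m-x), b = e^(m+x), S = `logSinhc`. For r ≠ 0, 1, L_r = exp(m + (S(rx) - S(x))/(r-1)).
As S is even, L_r and L_{-r} have exponents m + D ± rD with D = (S(rx) - S(x))/(r² - 1), so the
claim is exp(S(x) - D) < cosh(rD). Since √(1+z²) - 1 < log cosh z for z > 0, it suffices that K² +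
2K ≤ z² with K = S(x) - D, z = rD; this unfolds to the monotonicity of (S² + 2S)/x² on x > 0. The
latter amounts to S² + 2S ≤ c(1+S) with c = xS' = `cothDefect`, a consequence of Lazarević's
inequality cosh x ≤ (sinh x / x)³. At r = 1, D is replaced by its limit c/2; at r = +∞ the claim is
sinh x / x < cosh x. -/

/-- The logarithm of `sinh x / x`, i.e. of the ratio of the logarithmic to the geometric mean of
`exp (-x)` and `exp x`. -/
noncomputable def logSinhc (x : ℝ) : ℝ := log (sinh x / x)

/-- `x * coth x - 1`, i.e. `x` times the derivative of `logSinhc` at `x`. -/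
noncomputable def cothDefect (x : ℝ) : ℝ := x * cosh x / sinh x - 1

/-! ### Elementary hyperbolic inequalities -/

theorem nonneg_of_deriv_nonneg {f f' : ℝ → ℝ} (hf : ∀ x, HasDerivAt f (f' x) x) (h0 : f 0 = 0)
    (h' : ∀ x, 0 < x → 0 ≤ f' x) {x : ℝ} (hx : 0 ≤ x) : 0 ≤ f x := by
  have hm : MonotoneOn f (Ici 0) := by
    refine monotoneOn_of_hasDerivWithinAt_nonneg (f' := f') (convex_Ici 0)
      (fun y _ => (hf y).continuousAt.continuousWithinAt) (fun y _ => (hf y).hasDerivWithinAt) ?_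
    intro y hy
    rw [interior_Ici] at hy
    exact h' y hy
  have := hm (mem_Ici.2 le_rfl) (mem_Ici.2 hx) hx
  rwa [h0] at this

theorem sinh_lt_mul_cosh {x : ℝ} (hx : 0 < x) : sinh x < x * cosh x := by
  have hm : StrictMonoOn (fun y : ℝ => y * cosh y - sinh y) (Ici 0) := by
    refine strictMonoOn_of_deriv_pos (convex_Ici 0) (by fun_prop) ?_
    intro y hy
    rw [interior_Ici] at hy
    have h : HasDerivAt (fun y : ℝ => y * cosh y - sinh y) (1 * cosh y + y * sinh y - cosh y) y :=
      ((hasDerivAt_id y).mul (hasDerivAt_cosh y)).sub (hasDerivAt_sinh y)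
    rw [h.deriv]
    have := mul_pos hy (sinh_pos_iff.2 hy)
    linarith
  have := hm (mem_Ici.2 le_rfl) (mem_Ici.2 hx.le) hx
  simp only [zero_mul, sinh_zero, sub_zero] at this
  linarith

theorem two_mul_cosh_le {x : ℝ} (hx : 0 ≤ x) : 0 ≤ 2 + x * sinh x - 2 * cosh x := by
  refine nonneg_of_deriv_nonneg (f := fun y => 2 + y * sinh y - 2 * cosh y)
    (f' := fun y => (1 * sinh y + y * cosh y) - 2 * sinh y) ?_ (by simp) ?_ hx
  · intro y
    exact (((hasDerivAt_id y).mul (hasDerivAt_sinh y)).const_add 2).sub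
      ((hasDerivAt_cosh y).const_mul 2)
  · intro y hy
    have := sinh_lt_mul_cosh hy
    linarith

theorem three_mul_sinh_le {x : ℝ} (hx : 0 ≤ x) : 0 ≤ x * (cosh x + 2) - 3 * sinh x := by
  refine nonneg_of_deriv_nonneg (f := fun y => y * (cosh y + 2) - 3 * sinh y)
    (f' := fun y => (1 * (cosh y + 2) + y * sinh y) - 3 * cosh y) ?_ (by simp) ?_ hx
  · intro y
    exact ((hasDerivAt_id y).mul ((hasDerivAt_cosh y).add_const 2)).sub
      ((hasDerivAt_sinh y).const_mul 3)
  · intro y hy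
    have := two_mul_cosh_le hy.le
    linarith

/-! ### Analysis of log(sinh x / x) on the positive axis -/

theorem tendsto_sinh_div_self : Tendsto (fun x : ℝ => sinh x / x) (𝓝[>] 0) (𝓝 1) := by
  have h := (hasDerivAt_iff_tendsto_slope.1 (hasDerivAt_sinh 0)).mono_left
    (nhdsWithin_mono 0 (fun x (hx : 0 < x) => (ne_of_gt hx : x ∈ ({0} : Set ℝ)ᶜ)))
  rw [cosh_zero] at h
  refine h.congr fun x => ?_
  simp [slope_def_field]

theorem tendsto_logSinhc : Tendsto logSinhc (𝓝[>] 0) (𝓝 0) := by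
  have := tendsto_sinh_div_self.log one_ne_zero
  rwa [log_one] at this

theorem tendsto_cosh_zero : Tendsto (fun x : ℝ => cosh x) (𝓝[>] 0) (𝓝 1) := by
  have := (continuous_cosh.tendsto 0).mono_left (nhdsWithin_le_nhds (s := Ioi 0))
  rwa [cosh_zero] at this

theorem tendsto_cothDefect : Tendsto cothDefect (𝓝[>] 0) (𝓝 0) := by
  have := (tendsto_cosh_zero.div tendsto_sinh_div_self one_ne_zero).sub_const 1
  rw [div_one, sub_self] at this
  refine this.congr fun x => ?_
  rw [cothDefect, Pi.div_apply, div_div_eq_mul_div, mul_comm]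

theorem nonneg_of_monotoneOn_of_tendsto {f : ℝ → ℝ} (hf : MonotoneOn f (Ioi 0))
    (h0 : Tendsto f (𝓝[>] 0) (𝓝 0)) {x : ℝ} (hx : 0 < x) : 0 ≤ f x := by
  refine le_of_tendsto h0 ?_
  filter_upwards [Ioc_mem_nhdsGT hx] with y hy
  exact hf hy.1 hx hy.2

theorem nonneg_of_tendsto_of_deriv_nonneg {f f' : ℝ → ℝ}
    (hf : ∀ x, 0 < x → HasDerivAt f (f' x) x) (h0 : Tendsto f (𝓝[>] 0) (𝓝 0))
    (h' : ∀ x, 0 < x → 0 ≤ f' x) {x : ℝ} (hx : 0 < x) : 0 ≤ f x := by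
  refine nonneg_of_monotoneOn_of_tendsto ?_ h0 hx
  refine monotoneOn_of_hasDerivWithinAt_nonneg (f' := f') (convex_Ioi 0)
    (fun y hy => (hf y hy).continuousAt.continuousWithinAt) ?_ ?_ <;>
  · intro y hy
    rw [interior_Ioi] at hy
    first
      | exact (hf y hy).hasDerivWithinAt
      | exact h' y hy

theorem hasDerivAt_logSinhc {x : ℝ} (hx : 0 < x) : HasDerivAt logSinhc (cothDefect x / x) x := by
  have hs := sinh_pos_iff.2 hx
  have h := ((hasDerivAt_sinh x).div (hasDerivAt_id x) hx.ne').log (div_pos hs hx).ne'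
  refine h.congr_deriv ?_
  simp only [Pi.div_apply, id, cothDefect]
  field_simp

theorem hasDerivAt_cothDefect {x : ℝ} (hx : 0 < x) :
    HasDerivAt cothDefect ((x ^ 2 - cothDefect x - cothDefect x ^ 2) / x) x := by
  have hs := sinh_pos_iff.2 hx
  have h := (((hasDerivAt_id x).mul (hasDerivAt_cosh x)).div (hasDerivAt_sinh x) hs.ne').sub_const 1
  refine h.congr_deriv ?_
  simp only [Pi.mul_apply, id, cothDefect]
  field_simp
  ring

theorem cothDefect_pos {x : ℝ} (hx : 0 < x) : 0 < cothDefect x := by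
  rw [cothDefect, sub_pos, one_lt_div (sinh_pos_iff.2 hx)]
  exact sinh_lt_mul_cosh hx

theorem strictMonoOn_logSinhc : StrictMonoOn logSinhc (Ioi 0) := by
  refine strictMonoOn_of_hasDerivWithinAt_pos (f' := fun x => cothDefect x / x) (convex_Ioi 0)
    (fun y hy => (hasDerivAt_logSinhc hy).continuousAt.continuousWithinAt) ?_ ?_ <;>
  · intro y hy
    rw [interior_Ioi] at hy
    first
      | exact (hasDerivAt_logSinhc hy).hasDerivWithinAt
      | exact div_pos (cothDefect_pos hy) hy

theorem logSinhc_nonneg {x : ℝ} (hx : 0 < x) : 0 ≤ logSinhc x :=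
  nonneg_of_monotoneOn_of_tendsto strictMonoOn_logSinhc.monotoneOn tendsto_logSinhc hx

/-- Lazarević's inequality in logarithmic form. -/
theorem log_cosh_le {x : ℝ} (hx : 0 < x) : 0 ≤ 3 * logSinhc x - log (cosh x) := by
  refine nonneg_of_tendsto_of_deriv_nonneg (f := fun y => 3 * logSinhc y - log (cosh y))
    (f' := fun y => 3 * (cothDefect y / y) - sinh y / cosh y) ?_ ?_ ?_ hx
  · intro y hy
    exact ((hasDerivAt_logSinhc hy).const_mul 3).sub ((hasDerivAt_cosh y).log (cosh_pos y).ne')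
  · have := (tendsto_logSinhc.const_mul 3).sub (tendsto_cosh_zero.log one_ne_zero)
    simpa using this
  · intro y hy
    have hs := sinh_pos_iff.2 hy
    have hc := cosh_pos y
    -- By the double-angle formulas, this is twice the numerator of the derivative.
    have h := three_mul_sinh_le (x := 2 * y) (by positivity)
    rw [cosh_two_mul, sinh_two_mul] at h
    have hsq := cosh_sq y
    have e : 3 * (cothDefect y / y) - sinh y / cosh y =
        (y * (3 * cosh y ^ 2 - sinh y ^ 2) - 3 * (sinh y * cosh y)) /
          (y * sinh y * cosh y) := by
      rw [cothDefect]
      field_simp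
      ring
    rw [e]
    refine div_nonneg ?_ (by positivity)
    rw [hsq] at h ⊢
    linarith

theorem pow_three_mul_cosh_le {x : ℝ} (hx : 0 < x) : x ^ 3 * cosh x ≤ sinh x ^ 3 := by
  have hs := sinh_pos_iff.2 hx
  have h := log_cosh_le hx
  have h3 : log (cosh x) ≤ log ((sinh x / x) ^ 3) := by
    rw [log_pow]
    push_cast
    rw [logSinhc] at h
    linarith
  have h4 := (log_le_log_iff (cosh_pos x) (by positivity)).1 h3
  rw [div_pow, le_div_iff₀ (by positivity)] at h4
  linarith

/-- The difference tends to 0 at 0+, and its derivative has the sign of x²(1+c) - ((1+c)³ - 1),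
which is Lazarević's inequality because 1 + c = x coth x. -/
theorem logSinhc_le_sub_log {x : ℝ} (hx : 0 < x) :
    0 ≤ cothDefect x - log (1 + cothDefect x / 2) - logSinhc x := by
  refine nonneg_of_tendsto_of_deriv_nonneg
    (f := fun y => cothDefect y - log (1 + cothDefect y / 2) - logSinhc y)
    (f' := fun y => (y ^ 2 - cothDefect y - cothDefect y ^ 2) / y -
      ((y ^ 2 - cothDefect y - cothDefect y ^ 2) / y / 2) / (1 + cothDefect y / 2) -
        cothDefect y / y) ?_ ?_ ?_ hx
  · intro y hy
    have hc := cothDefect_pos hy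
    have hd := hasDerivAt_cothDefect hy
    exact (hd.sub (((hd.div_const 2).const_add 1).log (by positivity))).sub
      (hasDerivAt_logSinhc hy)
  · have h1 : Tendsto (fun y => log (1 + cothDefect y / 2)) (𝓝[>] 0) (𝓝 (log (1 + 0 / 2))) :=
      ((tendsto_cothDefect.div_const 2).const_add 1).log (by norm_num)
    have := (tendsto_cothDefect.sub h1).sub tendsto_logSinhc
    simpa using this
  · intro y hy
    have hs := sinh_pos_iff.2 hy
    have hc := cothDefect_pos hy
    have hl := pow_three_mul_cosh_le hy
    have key : 0 ≤ y ^ 2 * (1 + cothDefect y) - ((1 + cothDefect y) ^ 3 - 1) := by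
      have e : y ^ 2 * (1 + cothDefect y) - ((1 + cothDefect y) ^ 3 - 1) =
          (sinh y ^ 3 - y ^ 3 * cosh y * (cosh y ^ 2 - sinh y ^ 2)) / sinh y ^ 3 := by
        rw [cothDefect]
        field_simp
        ring
      rw [e, cosh_sq_sub_sinh_sq]
      refine div_nonneg ?_ (by positivity)
      linarith
    have e : (y ^ 2 - cothDefect y - cothDefect y ^ 2) / y -
        ((y ^ 2 - cothDefect y - cothDefect y ^ 2) / y / 2) / (1 + cothDefect y / 2) -
          cothDefect y / y =
        (y ^ 2 * (1 + cothDefect y) - ((1 + cothDefect y) ^ 3 - 1)) /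
          (y * (2 + cothDefect y)) := by
      field_simp
      ring
    rw [e]
    positivity

/-- Bounding log(1 + c/2) below by 2c/(c+4) turns the previous estimate into a rational bound S ≤ W.
-/
theorem logSinhc_quadratic_le {x : ℝ} (hx : 0 < x) :
    logSinhc x ^ 2 + 2 * logSinhc x ≤ cothDefect x * (1 + logSinhc x) := by
  have hc := cothDefect_pos hx
  have h := logSinhc_le_sub_log hx
  have hS := logSinhc_nonneg hx
  have hl := Real.le_log_one_add_of_nonneg (x := cothDefect x / 2) (by positivity)
  generalize cothDefect x = c at *
  generalize logSinhc x = S at *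
  have e : 2 * (c / 2) / (c / 2 + 2) = 2 * c / (c + 4) := by
    field_simp
    ring
  rw [e] at hl
  have hS' : S ≤ c * (c + 2) / (c + 4) := by
    have : c * (c + 2) / (c + 4) = c - 2 * c / (c + 4) := by
      field_simp
      ring
    linarith
  set W := c * (c + 2) / (c + 4) with hW
  have hWq : W ^ 2 + 2 * W - c * (1 + W) ≤ 0 := by
    have : W ^ 2 + 2 * W - c * (1 + W) = -c ^ 3 / (c + 4) ^ 2 := by
      rw [hW]
      field_simp
      ring
    rw [this]
    exact div_nonpos_of_nonpos_of_nonneg (by have := pow_pos hc 3; linarith) (by positivity)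
  have hWpos : 0 < W := by positivity
  -- The convex quadratic t² + 2t - c(1+t) is -c < 0 at t = 0 and nonpositive at W, hence
  -- nonpositive on [0, W].
  nlinarith [mul_nonneg hS (sub_nonneg.2 hS'), mul_nonneg hc.le (sub_nonneg.2 hS')]

theorem monotoneOn_logSinhc_quadratic_div_sq :
    MonotoneOn (fun x => (logSinhc x ^ 2 + 2 * logSinhc x) / x ^ 2) (Ioi 0) := by
  have hd : ∀ y : ℝ, 0 < y → HasDerivAt (fun x => (logSinhc x ^ 2 + 2 * logSinhc x) / x ^ 2)
      (2 * (cothDefect y * (1 + logSinhc y) - (logSinhc y ^ 2 + 2 * logSinhc y)) / y ^ 3) y := by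
    intro y hy
    have hS := hasDerivAt_logSinhc hy
    refine (((hS.pow 2).add (hS.const_mul 2)).div (hasDerivAt_pow 2 y)
      (by positivity)).congr_deriv ?_
    simp only [Pi.add_apply, Pi.pow_apply]
    push_cast
    field_simp
    ring
  refine monotoneOn_of_hasDerivWithinAt_nonneg (convex_Ioi 0)
    (fun y hy => (hd y hy).continuousAt.continuousWithinAt)
    (fun y hy => (hd y (by rwa [interior_Ioi] at hy)).hasDerivWithinAt) ?_
  intro y hy
  rw [interior_Ioi] at hy
  have hy : 0 < y := hy
  have := sub_nonneg.2 (logSinhc_quadratic_le hy)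
  positivity

/-! ### From quadratic to exponential inequalities -/

theorem sqrt_one_add_sq_sub_one_lt_log_cosh {z : ℝ} (hz : 0 < z) :
    √(1 + z ^ 2) - 1 < log (cosh z) := by
  have hd : ∀ y : ℝ, HasDerivAt (fun y => log (cosh y) - √(1 + y ^ 2))
      (sinh y / cosh y - y / √(1 + y ^ 2)) y := by
    intro y
    have h2 := ((hasDerivAt_pow 2 y).const_add 1).sqrt (by positivity)
    refine (((hasDerivAt_cosh y).log (cosh_pos y).ne').sub h2).congr_deriv ?_
    push_cast
    field_simp
  have hm : StrictMonoOn (fun y => log (cosh y) - √(1 + y ^ 2)) (Ici 0) := by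
    refine strictMonoOn_of_hasDerivWithinAt_pos (convex_Ici 0)
      (fun y _ => (hd y).continuousAt.continuousWithinAt)
      (fun y _ => (hd y).hasDerivWithinAt) ?_
    intro y hy
    rw [interior_Ici] at hy
    have hy : 0 < y := hy
    have hlt := self_lt_sinh_iff.2 hy
    rw [sub_pos, div_lt_div_iff₀ (by positivity) (cosh_pos y)]
    -- Squared, the comparison of derivatives reduces to y² < sinh² y.
    refine lt_of_pow_lt_pow_left₀ 2 (by positivity) ?_
    rw [mul_pow, mul_pow, sq_sqrt (by positivity), cosh_sq]
    nlinarith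
  have := hm (mem_Ici.2 le_rfl) (mem_Ici.2 hz.le) hz
  simp only [cosh_zero, log_one, ne_eq, OfNat.ofNat_ne_zero, not_false_eq_true, zero_pow, add_zero,
    sqrt_one] at this
  linarith

theorem exp_lt_cosh_of_quadratic_le {K z : ℝ} (hz : 0 < z) (h : K ^ 2 + 2 * K ≤ z ^ 2) :
    exp K < cosh z := by
  rw [← lt_log_iff_exp_lt (cosh_pos z)]
  refine lt_of_le_of_lt ?_ (sqrt_one_add_sq_sub_one_lt_log_cosh hz)
  have : K + 1 ≤ √(1 + z ^ 2) := le_sqrt_of_sq_le (by nlinarith)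
  linarith

theorem two_mul_exp_lt_exp_add_exp {S D z : ℝ} (hz : 0 < z)
    (h : (S - D) ^ 2 + 2 * (S - D) ≤ z ^ 2) : 2 * exp S < exp (D + z) + exp (D - z) := by
  have h1 := exp_lt_cosh_of_quadratic_le hz h
  have e : exp (D + z) + exp (D - z) = 2 * (exp D * cosh z) := by
    rw [cosh_eq, sub_eq_add_neg, exp_add, exp_add]
    ring
  have e' : exp S = exp D * exp (S - D) := by
    rw [← exp_add]
    ring_nf
  rw [e, e']
  have := mul_lt_mul_of_pos_left h1 (exp_pos D)
  linarith

theorem two_mul_exp_logSinhc_lt {x r : ℝ} (hx : 0 < x) (hr : 0 < r) (hr1 : r ≠ 1) :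
    2 * exp (logSinhc x) < exp ((logSinhc (r * x) - logSinhc x) / (r - 1)) +
      exp ((logSinhc (r * x) - logSinhc x) / (-r - 1)) := by
  have hrx : 0 < r * x := mul_pos hr hx
  have hr1' : r - 1 ≠ 0 := sub_ne_zero.2 hr1
  have hrn : r ^ 2 - 1 ≠ 0 := by
    have : r ^ 2 - 1 = (r - 1) * (r + 1) := by ring
    rw [this]
    exact mul_ne_zero hr1' (by positivity)
  have hrm : -r - 1 ≠ 0 := by linarith
  -- Both differences change sign at r = 1 together with r² - 1. The second quotient is exactly the
  -- slack z² - (K² + 2K), as `e3` verifies.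
  have hsgn : 0 < (logSinhc (r * x) - logSinhc x) / (r ^ 2 - 1) ∧
      0 ≤ (logSinhc (r * x) ^ 2 + 2 * logSinhc (r * x) -
        r ^ 2 * (logSinhc x ^ 2 + 2 * logSinhc x)) / (r ^ 2 - 1) := by
    rcases lt_or_gt_of_ne hr1 with h | h
    · have hlt : r * x < x := by nlinarith
      have h1 := strictMonoOn_logSinhc hrx hx hlt
      have h2 := monotoneOn_logSinhc_quadratic_div_sq hrx hx hlt.le
      simp only at h2
      rw [div_le_div_iff₀ (by positivity) (by positivity), mul_pow, ← mul_assoc] at h2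
      have h2 := le_of_mul_le_mul_right h2 (pow_pos hx 2)
      have hn : r ^ 2 - 1 < 0 := by nlinarith
      exact ⟨div_pos_of_neg_of_neg (by linarith) hn,
        div_nonneg_of_nonpos (by linarith) hn.le⟩
    · have hlt : x < r * x := by nlinarith
      have h1 := strictMonoOn_logSinhc hx hrx hlt
      have h2 := monotoneOn_logSinhc_quadratic_div_sq hx hrx hlt.le
      simp only at h2
      rw [div_le_div_iff₀ (by positivity) (by positivity), mul_pow, ← mul_assoc] at h2
      have h2 := le_of_mul_le_mul_right h2 (pow_pos hx 2)
      have hn : 0 < r ^ 2 - 1 := by nlinarith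
      exact ⟨div_pos (by linarith) hn, div_nonneg (by linarith) hn.le⟩
  generalize logSinhc (r * x) = Y at *
  generalize logSinhc x = X at *
  obtain ⟨hD, hQ⟩ := hsgn
  have e1 : (Y - X) / (r - 1) = (Y - X) / (r ^ 2 - 1) + r * ((Y - X) / (r ^ 2 - 1)) := by
    field_simp
    ring
  have e2 : (Y - X) / (-r - 1) = (Y - X) / (r ^ 2 - 1) - r * ((Y - X) / (r ^ 2 - 1)) := by
    field_simp
    ring
  rw [e1, e2]
  refine two_mul_exp_lt_exp_add_exp (mul_pos hr hD) ?_
  have e3 : (r * ((Y - X) / (r ^ 2 - 1))) ^ 2 - ((X - (Y - X) / (r ^ 2 - 1)) ^ 2 +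
      2 * (X - (Y - X) / (r ^ 2 - 1))) =
      (Y ^ 2 + 2 * Y - r ^ 2 * (X ^ 2 + 2 * X)) / (r ^ 2 - 1) := by
    field_simp
    ring
  linarith

theorem two_mul_exp_logSinhc_lt_exp_cothDefect_add_one {x : ℝ} (hx : 0 < x) :
    2 * exp (logSinhc x) < exp (cothDefect x) + 1 := by
  have hc := cothDefect_pos hx
  have hq := logSinhc_quadratic_le hx
  have h := two_mul_exp_lt_exp_add_exp (S := logSinhc x) (D := cothDefect x / 2)
    (z := cothDefect x / 2) (by positivity) (by nlinarith)
  rwa [add_halves, sub_self, exp_zero] at h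

/-! ### The means in exponential coordinates -/

theorem exp_logSinhc {x : ℝ} (hx : 0 < x) : exp (logSinhc x) = sinh x / x :=
  exp_log (div_pos (sinh_pos_iff.2 hx) hx)

theorem exp_add_sub_exp_sub (m x : ℝ) : exp (m + x) - exp (m - x) = 2 * exp m * sinh x := by
  rw [sinh_eq, sub_eq_add_neg m x, exp_add, exp_add]
  ring

theorem exp_sub_ne_exp_add {x : ℝ} (m : ℝ) (hx : 0 < x) : exp (m - x) ≠ exp (m + x) :=
  (exp_lt_exp.2 (by linarith)).ne

theorem genLogMeanReal_exp_zero (m : ℝ) {x : ℝ} (hx : 0 < x) :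
    genLogMeanReal 0 (exp (m - x)) (exp (m + x)) = exp m * exp (logSinhc x) := by
  rw [genLogMeanReal, if_neg (exp_sub_ne_exp_add m hx), if_pos rfl, exp_add_sub_exp_sub,
    log_exp, log_exp, exp_logSinhc hx, show m + x - (m - x) = 2 * x by ring]
  field_simp

theorem genLogMeanReal_exp_one (m : ℝ) {x : ℝ} (hx : 0 < x) :
    genLogMeanReal 1 (exp (m - x)) (exp (m + x)) = exp m * exp (cothDefect x) := by
  have hs := sinh_pos_iff.2 hx
  rw [genLogMeanReal, if_neg (exp_sub_ne_exp_add m hx), if_neg one_ne_zero, if_pos rfl,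
    ← exp_mul, ← exp_mul, ← exp_sub, ← exp_mul, one_div, ← exp_neg, ← exp_add, ← exp_add,
    exp_add_sub_exp_sub]
  congr 1
  have e : (m + x) * exp (m + x) - (m - x) * exp (m - x) =
      2 * exp m * (m * sinh x + x * cosh x) := by
    rw [sinh_eq, cosh_eq, sub_eq_add_neg m x, exp_add, exp_add]
    ring
  rw [e, cothDefect]
  field_simp
  ring

theorem genLogMeanReal_exp (m : ℝ) {x r : ℝ} (hx : 0 < x) (hr0 : r ≠ 0) (hr1 : r ≠ 1) :
    genLogMeanReal r (exp (m - x)) (exp (m + x)) =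
      exp m * exp ((logSinhc (r * x) - logSinhc x) / (r - 1)) := by
  have hs := sinh_pos_iff.2 hx
  have hrx : 0 < sinh (r * x) / (r * x) := by
    rcases lt_or_gt_of_ne hr0 with h | h
    · have := mul_neg_of_neg_of_pos h hx
      exact div_pos_of_neg_of_neg (sinh_neg_iff.2 this) this
    · have := mul_pos h hx
      exact div_pos (sinh_pos_iff.2 this) this
  have hr1' : r - 1 ≠ 0 := sub_ne_zero.2 hr1
  rw [genLogMeanReal, if_neg (exp_sub_ne_exp_add m hx), if_neg hr0, if_neg hr1, ← exp_mul,
    ← exp_mul, add_mul, sub_mul, mul_comm x r, exp_add_sub_exp_sub, exp_add_sub_exp_sub]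
  have e : 2 * exp (m * r) * sinh (r * x) / (r * (2 * exp m * sinh x)) =
      exp (m * (r - 1) + (logSinhc (r * x) - logSinhc x)) := by
    rw [exp_add, exp_sub, exp_logSinhc hx, logSinhc, exp_log hrx, mul_sub, mul_one, exp_sub]
    field_simp
  rw [e, ← exp_mul, ← exp_add]
  congr 1
  field_simp

theorem logSinhc_neg (x : ℝ) : logSinhc (-x) = logSinhc x := by
  rw [logSinhc, sinh_neg, neg_div_neg_eq, logSinhc]

theorem genLogMean_coe (r a b : ℝ) : genLogMean (r : EReal) a b = genLogMeanReal r a b := by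
  rw [genLogMean, if_neg (EReal.coe_ne_top r), if_neg (EReal.coe_ne_bot r), EReal.toReal_coe]

theorem genLogMeanReal_add_neg_gt {r x : ℝ} (m : ℝ) (hr : 0 < r) (hx : 0 < x) :
    2 * genLogMeanReal 0 (exp (m - x)) (exp (m + x)) <
      genLogMeanReal r (exp (m - x)) (exp (m + x)) +
        genLogMeanReal (-r) (exp (m - x)) (exp (m + x)) := by
  rw [genLogMeanReal_exp_zero m hx, genLogMeanReal_exp (r := -r) m hx (by linarith) (by linarith),
    neg_mul, logSinhc_neg]
  by_cases hr1 : r = 1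
  · subst hr1
    rw [genLogMeanReal_exp_one m hx, one_mul, sub_self, zero_div, exp_zero]
    have := mul_lt_mul_of_pos_left (two_mul_exp_logSinhc_lt_exp_cothDefect_add_one hx) (exp_pos m)
    linarith
  · rw [genLogMeanReal_exp m hx hr.ne' hr1]
    have := mul_lt_mul_of_pos_left (two_mul_exp_logSinhc_lt hx hr hr1) (exp_pos m)
    linarith

theorem two_mul_genLogMeanReal_zero_lt_add {x : ℝ} (m : ℝ) (hx : 0 < x) :
    2 * genLogMeanReal 0 (exp (m - x)) (exp (m + x)) < exp (m + x) + exp (m - x) := by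
  have e : exp (m + x) + exp (m - x) = 2 * (exp m * cosh x) := by
    rw [cosh_eq, sub_eq_add_neg, exp_add, exp_add]
    ring
  rw [genLogMeanReal_exp_zero m hx, exp_logSinhc hx, e]
  have h : sinh x / x < cosh x := by
    rw [div_lt_iff₀ hx, mul_comm]
    exact sinh_lt_mul_cosh hx
  have := mul_lt_mul_of_pos_left h (exp_pos m)
  linarith

theorem theorem3p1 (r : EReal) (hr : 0 < r) (a b : ℝ) (ha : 0 < a) (hab : a < b) :
    genLogMean r a b + genLogMean (-r) a b > 2 * genLogMean 0 a b := by
  have hb := ha.trans hab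
  -- e^m is the geometric mean of a and b, and 2x = log(b/a).
  obtain ⟨m, x, hx, rfl, rfl⟩ : ∃ m x : ℝ, 0 < x ∧ a = exp (m - x) ∧ b = exp (m + x) := by
    refine ⟨(log a + log b) / 2, (log b - log a) / 2, ?_, ?_, ?_⟩
    · have := log_lt_log ha hab
      linarith
    · rw [show (log a + log b) / 2 - (log b - log a) / 2 = log a by ring, exp_log ha]
    · rw [show (log a + log b) / 2 + (log b - log a) / 2 = log b by ring, exp_log hb]
  rw [gt_iff_lt, ← EReal.coe_zero, genLogMean_coe]
  induction r using EReal.rec with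
  | bot => exact absurd hr not_lt_bot
  | coe r =>
    rw [← EReal.coe_neg, genLogMean_coe, genLogMean_coe]
    exact genLogMeanReal_add_neg_gt m (EReal.coe_pos.1 hr) hx
  | top =>
    rw [EReal.neg_top, genLogMean, genLogMean, if_pos rfl, if_neg bot_ne_top, if_pos rfl,
      max_eq_right hab.le, min_eq_left hab.le]
    exact two_mul_genLogMeanReal_zero_lt_add m hx
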